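/- Let $q$ be an indeterminate and let $A$ be the $q$-deformed Weyl algebra, i.e. the associative unital $\mathbb{Z}[q]$-algebra generated by $x, D$ subject to the single relation $Dx = qxD + 1$. A Dyck word is a word $w$ in the letters $x, D$ with equally many $x$'s and $D$'s such that every initial segment has at least as many $x$'s as $D$'s (the empty word is allowed). Every non-empty Dyck word is uniquely $w = (x\,u\,D)\,v$ with $u, v$ (possibly empty) Dyck words; here $xuD$ is the first irreducible factor of $w$, and $w$ is irreducible exactly when $v$ is empty. *The graph.* $G_w$ is defined recursively: the empty word gives the empty graph, and for $w = (xuD)v$ the graph $G_w$ is the disjoint union of $G_{xuD}$ and $G_v$, where $G_{xuD}$ is obtained from $G_u$ by adding a new vertex adjacent to all vertices of $G_u$. (So $G_{xD} = K_1$, and a product of irreducible words $w_1 \cdots w_\ell$ gives the disjoint union of the $G_{w_i}$.) For $k \ge 0$ let $\mathcal{P}(w,k)$ be the set of partitions of the vertex set of $G_w$ into exactly $k$ non-empty independent sets. *The weight.* Fix an arbitrary strict total order on the set of independent sets of $G_w$; it induces a total order on the independent sets of every subgraph occurring in the recursive construction of $G_w$. For an $r \times s$ matrix $M$ with entries in $\{0,1\}$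 having at most one $1$ in each row and column, let $f(M)$ be the number of entries equal to $0$ that have no $1$ above them in the same column and no $1$ to the left of them in the same row. The weight $\mathrm{wt}(P) \in \mathbb{Z}_{\ge 0}$ of a partition $P$ of $G_w$ into non-empty independent sets is defined recursively. For the empty word and for $w = xD$, $\mathrm{wt}(P) = 0$. If $w = xuD$ with $u$ non-empty, then $P$ contains the added dominating vertex as a singleton part, and $\mathrm{wt}(P)$ is the weight of the partition of $G_u$ obtained by removing this part. If $w = (xuD)v$ with $v$ non-empty, let $P_1 = \{x_1 < \dots < x_r\}$ and $P_2 = \{y_1 < \dots < y_s\}$ be the partitions that $P$ induces on $G_{xuD}$ and $G_v$, with parts listed in increasing order, and let $M$ be the $r \times s$ matrix with $M_{ij} = 1$ if $x_i \cup y_j$ is a part of $P$ and $M_{ij} = 0$ otherwise; then $\mathrm{wt}(P) = \mathrm{wt}(P_1) + \mathrm{wt}(P_2) + f(M)$. **Theorem.** Let $w$ be a Dyck word. In $A$ there is a unique expansion $w = \sum_{k \ge 0} S^q_w(k)\, x^k D^k$ with $S^q_w(k) \in \mathbb{Z}[q]$, all but finitely many zero, and for every choice of the total order on the independent sets of $G_w$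 and every $k \ge 0$, $$\sum_{P \in \mathcal{P}(w,k)} q^{\mathrm{wt}(P)} = S^q_w(k).$$ -/

import Mathlib

open Polynomial

/-! ### The q-deformed Weyl algebra

Words in the alphabet `{x, D}` are lists of letters of type `DyckStep`, where the letter `U`
stands for `x` and the letter `D` stands for `D`.  The indeterminate `q` is `X : ℤ[X]`. -/

/-- The defining relation `D x = q x D + 1` on the free `ℤ[q]`-algebra on the two letters. -/
inductive QWeylRel : FreeAlgebra ℤ[X] DyckStep → FreeAlgebra ℤ[X] DyckStep → Prop
  | comm : QWeylRel
      (FreeAlgebra.ι ℤ[X] DyckStep.D * FreeAlgebra.ι ℤ[X] DyckStep.U)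
      ((X : ℤ[X]) • (FreeAlgebra.ι ℤ[X] DyckStep.U * FreeAlgebra.ι ℤ[X] DyckStep.D) + 1)

/-- The q-deformed Weyl algebra over `ℤ[q]`: generators `x, D`, relation `D x = q x D + 1`. -/
abbrev QWeyl : Type := RingQuot QWeylRel

/-- The generator of the q-deformed Weyl algebra given by a letter. -/
noncomputable def qGen (a : DyckStep) : QWeyl :=
  RingQuot.mkAlgHom ℤ[X] QWeylRel (FreeAlgebra.ι ℤ[X] a)

/-- The element of the q-deformed Weyl algebra given by a word (the product of its letters). -/
noncomputable def qEval (w : List DyckStep) : QWeyl := (w.map qGen).prod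

/-- `c` is a family of normal order coefficients of the word `w` (with equally many `x` and `D`):
`w = ∑ k, c k • x ^ k * D ^ k` in the q-deformed Weyl algebra. -/
def IsQNormalOrder (w : DyckWord) (c : ℕ →₀ ℤ[X]) : Prop :=
  qEval w.toList = c.sum fun k a => a • (qGen DyckStep.U ^ k * qGen DyckStep.D ^ k)

/-- The coefficient `S^q_w(k)` of `x ^ k * D ^ k` in the normal order of the Dyck word `w`. -/
noncomputable def qStirling (w : DyckWord) (k : ℕ) : ℤ[X] :=
  Classical.epsilon (IsQNormalOrder w) k

/-! ### The graph of a Dyck word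

A non-empty Dyck word is, in exactly one way, of the form `(x u D) v` with `u`, `v` Dyck words
(possibly empty); it is irreducible exactly if `v` is empty, and otherwise `x u D` is its first
irreducible factor and `v` is the product of the others.  `DyckWord.toTree` records this
recursive decomposition: the empty word goes to `nil`, and `(x u D) v` goes to the binary tree
`node () u.toTree v.toTree`.  The recursions below run along this tree. -/

/-- The graph obtained from `G` by adding a dominating vertex (the vertex `none`). -/
def addDominating {V : Type} (G : SimpleGraph V) : SimpleGraph (Option V) where
  Adj
    | none, none => False
    | none, some _ => True
    | some _, none => True
    | some a, some b => G.Adj a b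
  symm := ⟨by
    rintro (_ | a) (_ | b) h
    · exact h
    · trivial
    · trivial
    · exact G.symm.symm _ _ h⟩
  loopless := ⟨by
    rintro (_ | a) h
    · exact h
    · exact G.loopless.irrefl a h⟩

/-- The vertex type: for `(x u D) v`, the vertices of `u`, a new vertex, the vertices of `v`. -/
def TreeVertex : BinaryTree Unit → Type
  | .nil => Empty
  | .node _ l r => Option (TreeVertex l) ⊕ TreeVertex r

instance instFintypeTreeVertex : ∀ t : BinaryTree Unit, Fintype (TreeVertex t)
  | .nil => inferInstanceAs (Fintype Empty)
  | .node _ l r =>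
    haveI := instFintypeTreeVertex l
    haveI := instFintypeTreeVertex r
    inferInstanceAs (Fintype (Option (TreeVertex l) ⊕ TreeVertex r))

instance instDecidableEqTreeVertex : ∀ t : BinaryTree Unit, DecidableEq (TreeVertex t)
  | .nil => inferInstanceAs (DecidableEq Empty)
  | .node _ l r =>
    haveI := instDecidableEqTreeVertex l
    haveI := instDecidableEqTreeVertex r
    inferInstanceAs (DecidableEq (Option (TreeVertex l) ⊕ TreeVertex r))

/-- The graph of `(x u D) v`: add a dominating vertex to the graph of `u`, and take the disjoint
union with the graph of `v`. -/
def treeGraph : ∀ t : BinaryTree Unit, SimpleGraph (TreeVertex t)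
  | .nil => (⊥ : SimpleGraph Empty)
  | .node _ l r => (addDominating (treeGraph l)).sum (treeGraph r)

/-- The vertex set of the graph `G_w`. -/
abbrev DyckVertex (w : DyckWord) : Type := TreeVertex w.toTree

/-- The graph `G_w` of a Dyck word `w`. -/
def dyckGraph (w : DyckWord) : SimpleGraph (DyckVertex w) := treeGraph w.toTree

open Classical in
/-- The set of partitions of (the vertex set of) `G` into `k` non-empty independent sets. -/
noncomputable def indepPartitions {V : Type} [Fintype V] [DecidableEq V] (G : SimpleGraph V)
    (k : ℕ) : Finset (Finpartition (Finset.univ : Finset V)) :=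
  Finset.univ.filter fun P => P.parts.card = k ∧ ∀ s ∈ P.parts, G.IsIndepSet (s : Set V)

/-! ### The weight of a partition -/

open Classical in
/-- The weight `f(M)` of a 0-1 matrix whose rows and columns are indexed by finite sets with
strict orders `rowLt` (top to bottom) and `colLt` (left to right): the number of entries `0`
that have no `1` above them in their column and no `1` to the left of them in their row. -/
noncomputable def matrixWeight {ι κ : Type} [Fintype ι] [Fintype κ]
    (rowLt : ι → ι → Prop) (colLt : κ → κ → Prop) (M : Matrix ι κ ℕ) : ℕ :=
  (Finset.univ.filter fun p : ι × κ => M p.1 p.2 = 0 ∧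
    (¬ ∃ i, rowLt i p.1 ∧ M i p.2 = 1) ∧ ¬ ∃ j, colLt j p.2 ∧ M p.1 j = 1).card

/-- The family induced by a family `P` of sets on a subset, given as the domain of an injection
`e`: the non-empty sets among the intersections (pullbacks) of the members of `P`. -/
def restrictParts {V W : Type} [Fintype V] [DecidableEq V] [DecidableEq W] (e : V ↪ W)
    (P : Finset (Finset W)) : Finset (Finset V) :=
  (P.image fun s => Finset.univ.filter fun a => e a ∈ s).erase ∅

/-- The relation induced on the subsets of the domain of an injection `e`. -/
def restrictLt {V W : Type} (e : V ↪ W) (lt : Finset W → Finset W → Prop) :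
    Finset V → Finset V → Prop :=
  fun s t => lt (s.map e) (t.map e)

/-- The matrix that records how a partition `P` of a disjoint union is obtained from the
partitions that it induces on the two sides: the entry at `(x, y)` is `1` if `x ∪ y` is a part
of `P`, and `0` otherwise. -/
def mergeMatrix {V W : Type} [Fintype V] [Fintype W] [DecidableEq V] [DecidableEq W]
    (P : Finset (Finset (V ⊕ W))) :
    Matrix (restrictParts Function.Embedding.inl P) (restrictParts Function.Embedding.inr P) ℕ :=
  Matrix.of fun x y => if (x : Finset V).disjSum (y : Finset W) ∈ P then 1 else 0

/-- The weight of a partition `P` (given by its set of parts) of the graph of a Dyck word, with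
respect to a strict total order `lt` on independent sets.  For `w = (x u D) v`, let `P₁` and `P₂`
be the partitions that `P` induces on the graphs of `x u D` and `v`.  The weight of `P₁` is that
of the partition of the graph of `u` obtained by removing the part consisting of the dominating
vertex.  The rows and columns of the merge matrix are taken in increasing order.  If `v` is empty,
then `P₂` and the matrix are empty, and the weight of `P` is that of `P₁`. -/
noncomputable def treeWeight : ∀ t : BinaryTree Unit,
    (Finset (TreeVertex t) → Finset (TreeVertex t) → Prop) → Finset (Finset (TreeVertex t)) → ℕ
  | .nil, _, _ => 0
  | .node _ l r, lt, P =>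
    let inL : Option (TreeVertex l) ↪ Option (TreeVertex l) ⊕ TreeVertex r := .inl
    let inR : TreeVertex r ↪ Option (TreeVertex l) ⊕ TreeVertex r := .inr
    let lt₁ : Finset (Option (TreeVertex l)) → Finset (Option (TreeVertex l)) → Prop :=
      restrictLt inL lt
    let lt₂ : Finset (TreeVertex r) → Finset (TreeVertex r) → Prop := restrictLt inR lt
    let P₁ : Finset (Finset (Option (TreeVertex l))) := restrictParts inL P
    let P₂ : Finset (Finset (TreeVertex r)) := restrictParts inR P
    treeWeight l (restrictLt .some lt₁) (restrictParts .some P₁) + treeWeight r lt₂ P₂ +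
      matrixWeight (fun x x' : P₁ => lt₁ x x') (fun y y' : P₂ => lt₂ y y')
        (mergeMatrix (V := Option (TreeVertex l)) (W := TreeVertex r) P)

/-- The weight `wt(P)` of a partition `P` of `G_w`. -/
noncomputable def dyckWeight (w : DyckWord)
    (lt : Finset (DyckVertex w) → Finset (DyckVertex w) → Prop)
    (P : Finpartition (Finset.univ : Finset (DyckVertex w))) : ℕ :=
  treeWeight w.toTree lt P.parts

/-! ### Commutation in a `ℤ[q]`-algebra with `d x = q x d + 1` -/

section Commutation

variable {A : Type*} [Semiring A] [Algebra ℤ[X] A] {x d : A}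

/-! Both sides satisfy the same recursion along `w = (x u D) v`. If `u` is a sum of terms `q^wt x^k
D^k` over partitions of `G_u`, then `x u D` is the sum of the `q^wt x^(k+1) D^(k+1)`, and the new
dominating vertex must indeed be a singleton part (`sum_indepFamilies_addDominating`).

For the product with `v`, the terms are `x^r D^r x^s D^s`, and only `D^r x^s` is out of order. By
`sum_rookPlacements` it is a sum over non-attacking rook placements on an `r × s` board: `i` rooks
contribute `x^(s-i) D^(r-i)`, with exponent of `q` given by the statistic `f`. A partition of a
disjoint union is the same as a partition of each side plus a rook placement saying which parts are
merged (`sum_indepFamilies_sum`), and `i` merges lower the number of parts by `i`. The rook sum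
depends only on `r` and `s`, so the choice of order does not matter.

Uniqueness comes from the action on coefficient sequences, `x` as a shift and `D` as a
`q`-derivative, under which the `x^k D^k` become linearly independent. -/

theorem d_mul_x_pow (h : d * x = (X : ℤ[X]) • (x * d) + 1) (n : ℕ) :
    d * x ^ n = (X ^ n : ℤ[X]) • (x ^ n * d) + (∑ i ∈ Finset.range n, X ^ i : ℤ[X]) • x ^ (n - 1) := by
  induction n with
  | zero => simp
  | succ n ih =>
    -- For `n = 0` the exponent `n - 1` is truncated, but the coefficient is an empty sum.
    have key : (∑ i ∈ Finset.range n, X ^ i : ℤ[X]) • (x ^ (n - 1) * x) =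
        (∑ i ∈ Finset.range n, X ^ i : ℤ[X]) • x ^ n := by
      rcases n with _ | n
      · simp
      · rw [Nat.add_sub_cancel, pow_succ]
    rw [pow_succ, ← mul_assoc, ih, add_mul, smul_mul_assoc, smul_mul_assoc, key, mul_assoc, h,
      mul_add, mul_smul_comm, smul_add, smul_smul, ← mul_assoc, ← pow_succ, ← pow_succ, mul_one,
      add_assoc, ← add_smul, Finset.sum_range_succ_comm, Nat.add_sub_cancel]

end Commutation

/-! ### Relations that are strict total orders on a set -/

/-- The relation `r` restricts to a strict total order on the set `s`. -/
structure StrictTotalOn {α : Type*} (r : α → α → Prop) (s : Set α) : Prop where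
  irrefl : ∀ a ∈ s, ¬ r a a
  trans : ∀ a ∈ s, ∀ b ∈ s, ∀ c ∈ s, r a b → r b c → r a c
  total : ∀ a ∈ s, ∀ b ∈ s, a ≠ b → r a b ∨ r b a

namespace StrictTotalOn

variable {α β : Type*} {r : α → α → Prop} {s t : Set α}

theorem mono (h : StrictTotalOn r t) (hst : s ⊆ t) : StrictTotalOn r s where
  irrefl a ha := h.irrefl a (hst ha)
  trans a ha b hb c hc := h.trans a (hst ha) b (hst hb) c (hst hc)
  total a ha b hb := h.total a (hst ha) b (hst hb)

theorem swap (h : StrictTotalOn r s) : StrictTotalOn (fun a b => r b a) s where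
  irrefl a ha := h.irrefl a ha
  trans a ha b hb c hc hab hbc := h.trans c hc b hb a ha hbc hab
  total a ha b hb hab := (h.total a ha b hb hab).symm

theorem comap (h : StrictTotalOn r t) {f : β → α} (hf : Function.Injective f) {s : Set β}
    (hst : Set.MapsTo f s t) : StrictTotalOn (fun a b => r (f a) (f b)) s where
  irrefl _ ha := h.irrefl _ (hst ha)
  trans _ ha _ hb _ hc := h.trans _ (hst ha) _ (hst hb) _ (hst hc)
  total _ ha _ hb hab := h.total _ (hst ha) _ (hst hb) (hf.ne hab)

theorem asymm (h : StrictTotalOn r s) {a b : α} (ha : a ∈ s) (hb : b ∈ s) (hab : r a b) :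
    ¬ r b a :=
  fun hba => h.irrefl a ha (h.trans a ha b hb a ha hab hba)

theorem exists_min {s : Finset α} (h : StrictTotalOn r s) (hs : s.Nonempty) :
    ∃ a ∈ s, ∀ b ∈ s, b ≠ a → r a b := by
  classical
  induction hs using Finset.Nonempty.cons_induction with
  | singleton a => exact ⟨a, by simp, by simp⟩
  | cons a s ha hs ih =>
    obtain ⟨m, hm, hmin⟩ := ih (h.mono (by intro; simp +contextual))
    have hm' : m ∈ ((Finset.cons a s ha : Finset α) : Set α) := by simp [hm]
    have ha' : a ∈ ((Finset.cons a s ha : Finset α) : Set α) := by simp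
    rcases h.total a ha' m hm' (by rintro rfl; exact ha hm) with ham | hma
    · refine ⟨a, by simp, fun b hb hba => ?_⟩
      rcases Finset.mem_cons.1 hb with rfl | hbs
      · exact absurd rfl hba
      · by_cases hbm : b = m
        · exact hbm ▸ ham
        · exact h.trans a ha' m hm' b hb ham (hmin b hbs hbm)
    · refine ⟨m, by simp [hm], fun b hb hbm => ?_⟩
      rcases Finset.mem_cons.1 hb with rfl | hbs
      · exact hma
      · exact hmin b hbs hbm

open Classical in
/-- The ranks of the elements of a totally ordered finite set are `0, 1, 2, …`. -/
theorem sum_card_filter_lt {M : Type*} [AddCommMonoid M] (f : ℕ → M) (s : Finset α)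
    (h : StrictTotalOn r s) :
    ∑ a ∈ s, f (s.filter fun b => r b a).card = ∑ i ∈ Finset.range s.card, f i := by
  induction hn : s.card generalizing s with
  | zero => simp [Finset.card_eq_zero.1 hn]
  | succ n ih =>
    -- Removing the maximum leaves all other ranks unchanged; the maximum itself has rank `n`.
    obtain ⟨m, hm, hmax⟩ := h.swap.exists_min (Finset.card_pos.1 (by omega))
    have hcard : (s.erase m).card = n := by rw [Finset.card_erase_of_mem hm]; omega
    rw [← Finset.sum_erase_add _ _ hm, Finset.sum_range_succ,
      ← ih (s.erase m) (h.mono (by simp)) hcard]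
    congr 1
    · refine Finset.sum_congr rfl fun a ha => ?_
      have ha' := Finset.mem_erase.1 ha
      congr 2
      ext b
      simp only [Finset.mem_filter, Finset.mem_erase]
      refine ⟨fun hb => ⟨⟨?_, hb.1⟩, hb.2⟩, fun hb => ⟨hb.1.2, hb.2⟩⟩
      rintro rfl
      exact h.asymm hb.1 ha'.2 hb.2 (hmax a ha'.2 ha'.1)
    · rw [← hcard]
      congr 2
      ext b
      simp only [Finset.mem_filter, Finset.mem_erase]
      refine ⟨fun hb => ⟨?_, hb.1⟩, fun hb => ⟨hb.2, hmax b hb.2 hb.1⟩⟩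
      rintro rfl
      exact h.irrefl _ hb.1 hb.2

end StrictTotalOn

/-! ### Rook placements -/

section Rook

variable {α β : Type*}

/-- Any two cells of `S` that lie in the same row or the same column are equal. -/
def IsNonAttacking (S : Finset (α × β)) : Prop :=
  ∀ p ∈ S, ∀ p' ∈ S, p.1 = p'.1 ∨ p.2 = p'.2 → p = p'

open Classical in
/-- The placements of non-attacking rooks on the board `A × B`. -/
noncomputable def rookPlacements (A : Finset α) (B : Finset β) : Finset (Finset (α × β)) :=
  (A ×ˢ B).powerset.filter IsNonAttacking

open Classical in
/-- The number of empty cells of the board `A × B` with no rook above and no rook to the left. -/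
noncomputable def rookWeight [DecidableEq α] [DecidableEq β] (r : α → α → Prop)
    (s : β → β → Prop) (A : Finset α) (B : Finset β) (S : Finset (α × β)) : ℕ :=
  ((A ×ˢ B).filter fun p => p ∉ S ∧ (∀ i, (i, p.2) ∈ S → ¬ r i p.1) ∧
    ∀ j, (p.1, j) ∈ S → ¬ s j p.2).card

theorem mem_rookPlacements {A : Finset α} {B : Finset β} {S : Finset (α × β)} :
    S ∈ rookPlacements A B ↔ (∀ p ∈ S, p.1 ∈ A ∧ p.2 ∈ B) ∧ IsNonAttacking S := by
  simp only [rookPlacements, Finset.mem_filter, Finset.mem_powerset, Finset.subset_iff,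
    Finset.mem_product]

theorem rookPlacements_empty (B : Finset β) : rookPlacements (∅ : Finset α) B = {∅} := by
  ext S
  simp only [mem_rookPlacements, Finset.notMem_empty, false_and, imp_false, Finset.mem_singleton]
  constructor
  · exact fun h => Finset.eq_empty_of_forall_notMem h.1
  · rintro rfl
    exact ⟨by simp, by simp [IsNonAttacking]⟩

theorem card_le_of_mem_rookPlacements {A : Finset α} {B : Finset β} {S : Finset (α × β)}
    (hS : S ∈ rookPlacements A B) : S.card ≤ A.card ∧ S.card ≤ B.card := by
  rw [mem_rookPlacements] at hS
  constructor
  · exact Finset.card_le_card_of_injOn Prod.fst (fun p hp => (hS.1 p hp).1)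
      fun p hp p' hp' h => hS.2 p hp p' hp' (.inl h)
  · exact Finset.card_le_card_of_injOn Prod.snd (fun p hp => (hS.1 p hp).2)
      fun p hp p' hp' h => hS.2 p hp p' hp' (.inr h)

variable [DecidableEq α] [DecidableEq β]

/-- Row `a` holds no rook or exactly one, and a rook in column `b` bars that column to the other
rows. -/
theorem rookPlacements_insert {a : α} {A : Finset α} (ha : a ∉ A) (B : Finset β) :
    rookPlacements (insert a A) B = rookPlacements A B ∪
      B.biUnion fun b => (rookPlacements A (B.erase b)).image (insert (a, b)) := by
  ext S
  simp only [Finset.mem_union, Finset.mem_biUnion, Finset.mem_image, mem_rookPlacements]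
  constructor
  · rintro ⟨hS, hna⟩
    by_cases h : ∃ b, (a, b) ∈ S
    · obtain ⟨b, hb⟩ := h
      refine .inr ⟨b, (hS _ hb).2, S.erase (a, b), ⟨fun p hp => ?_, fun p hp p' hp' =>
        hna p (Finset.mem_of_mem_erase hp) p' (Finset.mem_of_mem_erase hp')⟩,
        Finset.insert_erase hb⟩
      obtain ⟨hne, hp⟩ := Finset.mem_erase.1 hp
      refine ⟨(Finset.mem_insert.1 (hS p hp).1).resolve_left fun h => ?_,
        Finset.mem_erase.2 ⟨fun h => ?_, (hS p hp).2⟩⟩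
      · exact hne (hna p hp _ hb (.inl h))
      · exact hne (hna p hp _ hb (.inr h))
    · refine .inl ⟨fun p hp => ⟨(Finset.mem_insert.1 (hS p hp).1).resolve_left ?_, (hS p hp).2⟩,
        hna⟩
      rintro rfl
      exact h ⟨p.2, hp⟩
  · rintro (⟨hS, hna⟩ | ⟨b, hb, S, ⟨hS, hna⟩, rfl⟩)
    · exact ⟨fun p hp => ⟨Finset.mem_insert_of_mem (hS p hp).1, (hS p hp).2⟩, hna⟩
    · have hne : ∀ p ∈ S, p.1 ≠ a ∧ p.2 ≠ b := fun p hp =>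
        ⟨fun h => ha (h ▸ (hS p hp).1), (Finset.mem_erase.1 (hS p hp).2).1⟩
      refine ⟨fun p hp => ?_, fun p hp p' hp' => ?_⟩
      · rcases Finset.mem_insert.1 hp with rfl | hp
        · exact ⟨Finset.mem_insert_self _ _, hb⟩
        · exact ⟨Finset.mem_insert_of_mem (hS p hp).1, Finset.mem_of_mem_erase (hS p hp).2⟩
      · have := hne p
        have := hne p'
        rcases Finset.mem_insert.1 hp with rfl | hp <;>
          rcases Finset.mem_insert.1 hp' with rfl | hp'
        · simp
        · grind
        · grind
        · exact hna p hp p' hp'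

/-- The pieces in `rookPlacements_insert` are told apart by the content of row `a`, so they are
disjoint. -/
theorem sum_rookPlacements_insert {M : Type*} [AddCommMonoid M] {a : α} {A : Finset α}
    (ha : a ∉ A) (B : Finset β) (g : Finset (α × β) → M) :
    ∑ S ∈ rookPlacements (insert a A) B, g S = ∑ S ∈ rookPlacements A B, g S +
      ∑ b ∈ B, ∑ S ∈ rookPlacements A (B.erase b), g (insert (a, b) S) := by
  have hnot : ∀ (B' : Finset β), ∀ S ∈ rookPlacements A B', ∀ b, (a, b) ∉ S :=
    fun B' S hS b hb => ha ((mem_rookPlacements.1 hS).1 _ hb).1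
  rw [rookPlacements_insert ha, Finset.sum_union, Finset.sum_biUnion]
  · congr 1
    refine Finset.sum_congr rfl fun b _ => Finset.sum_image fun S hS S' hS' h => ?_
    have := congrArg (fun T => T.erase (a, b)) h
    simpa [Finset.erase_insert (hnot _ S hS b), Finset.erase_insert (hnot _ S' hS' b)] using this
  · intro b _ b' _ hbb'
    refine Finset.disjoint_left.2 fun T hT hT' => ?_
    obtain ⟨S, hS, rfl⟩ := Finset.mem_image.1 hT
    obtain ⟨S', hS', h⟩ := Finset.mem_image.1 hT'
    have : (a, b') ∈ insert (a, b) S := h ▸ Finset.mem_insert_self _ _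
    rcases Finset.mem_insert.1 this with h | h
    · exact hbb' (Prod.ext_iff.1 h).2.symm
    · exact hnot _ S hS _ h
  · refine Finset.disjoint_left.2 fun T hT hT' => ?_
    simp only [Finset.mem_biUnion, Finset.mem_image] at hT'
    obtain ⟨b, _, S, _, rfl⟩ := hT'
    exact hnot _ _ hT b (Finset.mem_insert_self _ _)

variable {r : α → α → Prop} {s : β → β → Prop}

open Classical in
theorem rookWeight_insert_left {a : α} {A : Finset α} (ha : a ∉ A) {B : Finset β}
    {S : Finset (α × β)} :
    rookWeight r s (insert a A) B S = (B.filter fun b => (a, b) ∉ S ∧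
      (∀ i, (i, b) ∈ S → ¬ r i a) ∧ ∀ j, (a, j) ∈ S → ¬ s j b).card + rookWeight r s A B S := by
  have hprod : insert a A ×ˢ B = B.image (Prod.mk a) ∪ A ×ˢ B := by
    ext ⟨i, j⟩
    simp only [Finset.mem_product, Finset.mem_insert, Finset.mem_union, Finset.mem_image,
      Prod.mk.injEq]
    grind
  rw [rookWeight, hprod, Finset.filter_union, Finset.card_union_of_disjoint,
    Finset.filter_image, Finset.card_image_of_injective _ (Prod.mk_right_injective a)]
  · rfl
  · refine Finset.disjoint_left.2 fun p hp hp' => ?_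
    simp only [Finset.mem_filter, Finset.mem_image, Finset.mem_product] at hp hp'
    obtain ⟨⟨b, _, rfl⟩, _⟩ := hp
    exact ha hp'.1.1

/-- No rook lies in row `a` or above it, so each of its cells counts; being empty, it affects no
other row. -/
theorem rookWeight_insert_of_row_empty {a : α} {A : Finset α} (ha : a ∉ A)
    (hr : ∀ i ∈ A, ¬ r i a) {B : Finset β} {S : Finset (α × β)} (hS : S ∈ rookPlacements A B) :
    rookWeight r s (insert a A) B S = B.card + rookWeight r s A B S := by
  rw [mem_rookPlacements] at hS
  classical
  rw [rookWeight_insert_left ha, Finset.filter_true_of_mem]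
  exact fun b _ => ⟨fun h => ha (hS.1 _ h).1, fun i hi => hr i (hS.1 _ hi).1,
    fun j hj => absurd (hS.1 _ hj).1 ha⟩

open Classical in
-- In the top row exactly the cells left of the rook count. The rook is above every other cell of
-- its column, so no cell of column `b` counts and the column can be deleted.
theorem rookWeight_insert_of_rook {a : α} {A : Finset α} (ha : a ∉ A)
    (hr : ∀ i ∈ A, r a i) (hr' : ¬ r a a) {B : Finset β} (hs : StrictTotalOn s B) {b : β}
    (hb : b ∈ B) {S : Finset (α × β)} (hr'' : ∀ i ∈ A, ¬ r i a)
    (hS : S ∈ rookPlacements A (B.erase b)) :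
    rookWeight r s (insert a A) B (insert (a, b) S) =
      (B.filter fun b' => s b' b).card + rookWeight r s A (B.erase b) S := by
  rw [mem_rookPlacements] at hS
  rw [rookWeight_insert_left ha]
  congr 1
  · congr 1
    refine Finset.filter_congr fun b' hb' => ?_
    constructor
    · rintro ⟨h1, -, h3⟩
      have h4 : b' ≠ b := by rintro rfl; exact h1 (Finset.mem_insert_self _ _)
      exact (hs.total b' hb' b hb h4).resolve_right (h3 b (Finset.mem_insert_self _ _))
    · intro h
      have h4 : b' ≠ b := by rintro rfl; exact hs.irrefl _ hb h
      refine ⟨fun h' => ?_, fun i hi => ?_, fun j hj => ?_⟩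
      · rcases Finset.mem_insert.1 h' with h' | h'
        · exact h4 (Prod.ext_iff.1 h').2
        · exact ha (hS.1 _ h').1
      · rcases Finset.mem_insert.1 hi with h' | h'
        · exact absurd (Prod.ext_iff.1 h').2 h4
        · exact hr'' i (hS.1 _ h').1
      · rcases Finset.mem_insert.1 hj with h' | h'
        · rw [show j = b from (Prod.ext_iff.1 h').2]; exact hs.asymm hb' hb h
        · exact absurd (hS.1 _ h').1 ha
  · unfold rookWeight
    congr 1
    ext ⟨i, j⟩
    simp only [Finset.mem_filter, Finset.mem_product, Finset.mem_insert, Prod.mk.injEq,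
      Finset.mem_erase]
    constructor
    · rintro ⟨⟨hi, hj⟩, h1, h2, h3⟩
      have hjb : j ≠ b := by rintro rfl; exact h2 a (.inl ⟨rfl, rfl⟩) (hr i hi)
      exact ⟨⟨hi, hjb, hj⟩, fun h => h1 (.inr h), fun i' h => h2 i' (.inr h),
        fun j' h => h3 j' (.inr h)⟩
    · rintro ⟨⟨hi, hjb, hj⟩, h1, h2, h3⟩
      have hia : i ≠ a := by rintro rfl; exact ha hi
      refine ⟨⟨hi, hj⟩, ?_, ?_, ?_⟩
      · rintro (h | h)
        · exact hjb h.2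
        · exact h1 h
      · rintro i' (h | h)
        · exact absurd h.2 hjb
        · exact h2 i' h
      · rintro j' (h | h)
        · exact absurd h.1 hia
        · exact h3 j' h

/-- Normal ordering of `d ^ |A| * x ^ |B|` in terms of rook placements on `A × B`. -/
theorem sum_rookPlacements {R : Type*} [Semiring R] [Algebra ℤ[X] R] {x d : R}
    (h : d * x = (X : ℤ[X]) • (x * d) + 1) (A : Finset α) (B : Finset β)
    (hr : StrictTotalOn r A) (hs : StrictTotalOn s B) :
    ∑ S ∈ rookPlacements A B, (X ^ rookWeight r s A B S : ℤ[X]) •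
      (x ^ (B.card - S.card) * d ^ (A.card - S.card)) = d ^ A.card * x ^ B.card := by
  induction hn : A.card generalizing A B with
  | zero =>
    rw [Finset.card_eq_zero.1 hn]
    simp [rookPlacements_empty, rookWeight]
  | succ n ih =>
    -- Splitting off the top row corresponds to moving the rightmost `d` through `x ^ |B|` by
    -- `d_mul_x_pow`; its two terms match an empty top row and a top row with a rook.
    obtain ⟨a, ha, hmin⟩ := hr.exists_min (Finset.card_pos.1 (by omega))
    obtain ⟨A, haA, rfl⟩ : ∃ A', a ∉ A' ∧ A = insert a A' :=
      ⟨A.erase a, Finset.notMem_erase _ _, (Finset.insert_erase ha).symm⟩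
    have hcard : A.card = n := by rw [Finset.card_insert_of_notMem haA] at hn; omega
    have hrA : StrictTotalOn r A := hr.mono (by simp)
    have hlt : ∀ i ∈ A, r a i := fun i hi =>
      hmin i (Finset.mem_insert_of_mem hi) (by rintro rfl; exact haA hi)
    have hnlt : ∀ i ∈ A, ¬ r i a := fun i hi =>
      hr.asymm ha (Finset.mem_insert_of_mem hi) (hlt i hi)
    rw [sum_rookPlacements_insert haA, pow_succ, mul_assoc, d_mul_x_pow h, mul_add,
      mul_smul_comm, mul_smul_comm]
    congr 1
    · rw [← mul_assoc, ← ih A B hrA hs hcard, Finset.sum_mul, Finset.smul_sum]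
      refine Finset.sum_congr rfl fun S hS => ?_
      have := (card_le_of_mem_rookPlacements hS).1
      rw [rookWeight_insert_of_row_empty haA hnlt hS, pow_add, smul_mul_assoc, smul_smul,
        mul_assoc, ← pow_succ, Nat.sub_add_comm (by omega)]
    -- The `q`-integer is the sum of `q ^ rank b` over the columns `b` that the rook may occupy.
    · rw [← StrictTotalOn.sum_card_filter_lt (fun i => (X ^ i : ℤ[X])) B hs, Finset.sum_smul]
      refine Finset.sum_congr rfl fun b hb => ?_
      rw [← Finset.card_erase_of_mem hb, ← ih A (B.erase b) hrA (hs.mono (by simp)) hcard,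
        Finset.smul_sum]
      refine Finset.sum_congr rfl fun S hS => ?_
      have hnot : (a, b) ∉ S := fun h' => haA ((mem_rookPlacements.1 hS).1 _ h').1
      rw [rookWeight_insert_of_rook haA hlt (hr.irrefl a ha) hs hb hnlt hS, pow_add, smul_smul,
        Finset.card_insert_of_notMem hnot, Finset.card_erase_of_mem hb, Nat.add_sub_add_right,
        Nat.sub_right_comm, Nat.sub_sub]

end Rook

/-! ### Independent partitions as families of sets -/

section IndepFamily

variable {V W : Type}

/-- The family `P` is a partition of the vertex set of `G` into non-empty independent sets. -/
structure IsIndepPartition (G : SimpleGraph V) (P : Finset (Finset V)) : Prop where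
  empty_notMem : ∅ ∉ P
  exists_mem : ∀ v, ∃ s ∈ P, v ∈ s
  eq_of_mem : ∀ s ∈ P, ∀ t ∈ P, ∀ v ∈ s, v ∈ t → s = t
  indep : ∀ s ∈ P, G.IsIndepSet (s : Set V)

open Classical in
/-- The finite set of all partitions of `G` into non-empty independent sets. -/
noncomputable def indepFamilies [Fintype V] (G : SimpleGraph V) : Finset (Finset (Finset V)) :=
  Finset.univ.filter (IsIndepPartition G)

theorem mem_indepFamilies [Fintype V] {G : SimpleGraph V} {P : Finset (Finset V)} :
    P ∈ indepFamilies G ↔ IsIndepPartition G P := by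
  simp [indepFamilies]

/-- Passes to bare families of sets, on which `treeWeight` and `restrictParts` operate. -/
theorem sum_indepPartitions [Fintype V] [DecidableEq V] (G : SimpleGraph V) (k : ℕ)
    {M : Type*} [AddCommMonoid M] (F : Finset (Finset V) → M) :
    ∑ P ∈ indepPartitions G k, F P.parts =
      ∑ P ∈ (indepFamilies G).filter (fun P => P.card = k), F P := by
  classical
  refine Finset.sum_bij (fun P _ => P.parts) (fun P hP => ?_)
    (fun P _ Q _ h => Finpartition.ext h) (fun P hP => ?_) (fun _ _ => rfl)
  · simp only [indepPartitions, Finset.mem_filter, Finset.mem_univ, true_and] at hP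
    rw [Finset.mem_filter, mem_indepFamilies]
    exact ⟨⟨P.empty_notMem_parts, fun v => P.exists_mem (Finset.mem_univ v),
      fun s hs t ht v hv hv' => P.eq_of_mem_parts hs ht hv hv', hP.2⟩, hP.1⟩
  · rw [Finset.mem_filter, mem_indepFamilies] at hP
    obtain ⟨h, hk⟩ := hP
    refine ⟨Finpartition.ofExistsUnique P (fun p _ => Finset.subset_univ p) (fun v _ => ?_)
      h.empty_notMem, ?_, rfl⟩
    · obtain ⟨s, hs, hv⟩ := h.exists_mem v
      exact ⟨s, ⟨hs, hv⟩, fun t ht => h.eq_of_mem t ht.1 s hs v ht.2 hv⟩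
    · simp only [indepPartitions, Finset.mem_filter, Finset.mem_univ, true_and]
      exact ⟨hk, h.indep⟩

theorem isIndepSet_map {G : SimpleGraph V} {H : SimpleGraph W} {e : V ↪ W}
    (he : ∀ a b, H.Adj (e a) (e b) → G.Adj a b) {s : Finset V}
    (hs : G.IsIndepSet (s : Set V)) : H.IsIndepSet ((s.map e : Finset W) : Set W) := by
  intro a ha b hb hab hadj
  obtain ⟨a, ha', rfl⟩ := Finset.mem_map.1 ha
  obtain ⟨b, hb', rfl⟩ := Finset.mem_map.1 hb
  exact hs ha' hb' (fun h => hab (congrArg e h)) (he a b hadj)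

/-- Images of independent sets are independent, so the hypothesis on the order survives each step of
the recursion. -/
theorem StrictTotalOn.restrictLt {G : SimpleGraph V} {H : SimpleGraph W} {e : V ↪ W}
    (he : ∀ a b, H.Adj (e a) (e b) → G.Adj a b) {lt : Finset W → Finset W → Prop}
    (h : StrictTotalOn lt {s | H.IsIndepSet (s : Set W)}) :
    StrictTotalOn (restrictLt e lt) {s | G.IsIndepSet (s : Set V)} :=
  h.comap (Finset.map_injective e) fun _ hs => isIndepSet_map he hs

variable [Fintype V] [DecidableEq V] [DecidableEq W]

theorem mem_restrictParts {e : V ↪ W} {P : Finset (Finset W)} {t : Finset V} :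
    t ∈ restrictParts e P ↔ t ≠ ∅ ∧ ∃ s ∈ P, ∀ a, e a ∈ s ↔ a ∈ t := by
  simp [restrictParts, Finset.ext_iff]

theorem IsIndepPartition.restrictParts {G : SimpleGraph V} {H : SimpleGraph W} {e : V ↪ W}
    (he : ∀ a b, G.Adj a b → H.Adj (e a) (e b)) {P : Finset (Finset W)}
    (h : IsIndepPartition H P) : IsIndepPartition G (restrictParts e P) where
  empty_notMem := by simp [mem_restrictParts]
  exists_mem v := by
    obtain ⟨s, hs, hv⟩ := h.exists_mem (e v)
    refine ⟨Finset.univ.filter fun a => e a ∈ s, mem_restrictParts.2 ⟨?_, s, hs, by simp⟩,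
      by simpa using hv⟩
    exact Finset.ne_empty_of_mem (a := v) (by simpa using hv)
  eq_of_mem s hs t ht v hvs hvt := by
    obtain ⟨-, s', hs', h1⟩ := mem_restrictParts.1 hs
    obtain ⟨-, t', ht', h2⟩ := mem_restrictParts.1 ht
    obtain rfl := h.eq_of_mem s' hs' t' ht' (e v) ((h1 v).2 hvs) ((h2 v).2 hvt)
    ext a
    rw [← h1, ← h2]
  indep s hs := by
    obtain ⟨-, s', hs', h1⟩ := mem_restrictParts.1 hs
    intro a ha b hb hab hadj
    exact h.indep s' hs' ((h1 a).2 ha) ((h1 b).2 hb) (e.injective.ne hab) (he a b hadj)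

end IndepFamily

/-! ### Partitions of a graph with a dominating vertex -/

section Dominating

variable {V : Type} {G : SimpleGraph V}

/-- Any further vertex of the part would be adjacent to the dominating one. -/
theorem IsIndepPartition.mem_iff_of_addDominating {P : Finset (Finset (Option V))}
    (h : IsIndepPartition (addDominating G) P) {s : Finset (Option V)} (hs : s ∈ P) :
    none ∈ s ↔ s = {none} := by
  refine ⟨fun hn => Finset.eq_singleton_iff_unique_mem.2 ⟨hn, fun a ha => ?_⟩, by rintro rfl; simp⟩
  by_contra hne
  obtain ⟨a, rfl⟩ := Option.ne_none_iff_exists'.1 hne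
  exact h.indep s hs hn ha (by simp) trivial

variable [DecidableEq V]

/-- Add the part consisting of the dominating vertex. -/
def addSingletonPart (Q : Finset (Finset V)) : Finset (Finset (Option V)) :=
  insert {none} (Q.map (Finset.mapEmbedding Function.Embedding.some).toEmbedding)

theorem mem_addSingletonPart {Q : Finset (Finset V)} {s : Finset (Option V)} :
    s ∈ addSingletonPart Q ↔ s = {none} ∨ ∃ t ∈ Q, t.map .some = s := by
  simp [addSingletonPart]

theorem card_addSingletonPart (Q : Finset (Finset V)) :
    (addSingletonPart Q).card = Q.card + 1 := by
  rw [addSingletonPart, Finset.card_insert_of_notMem, Finset.card_map]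
  simp only [Finset.mem_map, not_exists, not_and]
  intro t _ h
  have : none ∈ t.map Function.Embedding.some := by
    rw [show t.map Function.Embedding.some = {none} from h]; simp
  simp at this

theorem IsIndepPartition.addSingletonPart {Q : Finset (Finset V)} (h : IsIndepPartition G Q) :
    IsIndepPartition (addDominating G) (addSingletonPart Q) where
  empty_notMem := by
    rw [mem_addSingletonPart]
    rintro (h' | ⟨t, ht, h'⟩)
    · simp at h'
    · rw [Finset.map_eq_empty] at h'
      exact h.empty_notMem (h' ▸ ht)
  exists_mem v := by
    rcases v with _ | v
    · exact ⟨{none}, mem_addSingletonPart.2 (.inl rfl), by simp⟩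
    · obtain ⟨t, ht, hv⟩ := h.exists_mem v
      exact ⟨t.map .some, mem_addSingletonPart.2 (.inr ⟨t, ht, rfl⟩), by simpa using hv⟩
  eq_of_mem s hs t ht v hvs hvt := by
    rcases mem_addSingletonPart.1 hs with rfl | ⟨s, hs', rfl⟩ <;>
      rcases mem_addSingletonPart.1 ht with rfl | ⟨t, ht', rfl⟩
    · rfl
    · obtain rfl := Finset.mem_singleton.1 hvs
      simp at hvt
    · obtain rfl := Finset.mem_singleton.1 hvt
      simp at hvs
    · obtain ⟨a, ha, rfl⟩ := Finset.mem_map.1 hvs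
      rw [Finset.mem_map' ] at hvt
      rw [h.eq_of_mem s hs' t ht' a ha hvt]
  indep s hs := by
    rcases mem_addSingletonPart.1 hs with rfl | ⟨s, hs', rfl⟩
    · simp
    · exact isIndepSet_map (fun _ _ h => h) (h.indep s hs')

variable [Fintype V]

/-- The part `{none}` has empty trace, which `restrictParts` discards. -/
theorem restrictParts_addSingletonPart {Q : Finset (Finset V)} (hQ : ∅ ∉ Q) :
    restrictParts .some (addSingletonPart Q) = Q := by
  ext t
  simp only [mem_restrictParts, mem_addSingletonPart]
  constructor
  · rintro ⟨hne, s, rfl | ⟨t', ht', rfl⟩, h⟩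
    · exact absurd (Finset.eq_empty_of_forall_notMem fun a ha => by simpa using (h a).2 ha) hne
    · have : t' = t := by ext a; rw [← h]; simp
      exact this ▸ ht'
  · exact fun ht => ⟨fun h => hQ (h ▸ ht), _, .inr ⟨t, ht, rfl⟩, by simp⟩

theorem IsIndepPartition.addSingletonPart_restrictParts {P : Finset (Finset (Option V))}
    (h : IsIndepPartition (addDominating G) P) :
    _root_.addSingletonPart (_root_.restrictParts .some P) = P := by
  ext s
  simp only [mem_restrictParts, mem_addSingletonPart]
  constructor
  · rintro (rfl | ⟨t, ⟨hne, s', hs', h1⟩, rfl⟩)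
    · obtain ⟨s, hs, hn⟩ := h.exists_mem none
      exact ((h.mem_iff_of_addDominating hs).1 hn) ▸ hs
    -- A part with non-empty trace is not `{none}`, hence avoids `none` and is the image of its
    -- trace.
    · have : s' = t.map .some := by
        ext a
        rcases a with _ | a
        · rw [h.mem_iff_of_addDominating hs']
          refine ⟨fun h' => ?_, by simp⟩
          obtain ⟨a, ha⟩ := Finset.nonempty_iff_ne_empty.2 hne
          have := (h1 a).2 ha
          simp [h'] at this
        · simpa using h1 a
      exact this ▸ hs'
  · intro hs
    by_cases hn : none ∈ s
    · exact .inl ((h.mem_iff_of_addDominating hs).1 hn)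
    · refine .inr ⟨Finset.univ.filter fun a => some a ∈ s, ⟨fun h' => ?_, s, hs, by simp⟩, ?_⟩
      · refine h.empty_notMem ((Finset.eq_empty_of_forall_notMem fun a ha => ?_ : s = ∅) ▸ hs)
        rcases a with _ | a
        · exact hn ha
        · exact Finset.eq_empty_iff_forall_notMem.1 h' a (by simpa using ha)
      · ext a
        rcases a with _ | a
        · simpa using hn
        · simp

/-- Deleting and adding the singleton part are inverse bijections. The number of parts is a separate
argument of `F` because it changes by one while the weight does not. -/
theorem sum_indepFamilies_addDominating (G : SimpleGraph V) {M : Type*} [AddCommMonoid M]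
    (F : Finset (Finset V) → ℕ → M) :
    ∑ P ∈ indepFamilies (addDominating G), F (restrictParts .some P) P.card =
      ∑ Q ∈ indepFamilies G, F Q (Q.card + 1) := by
  refine Finset.sum_nbij' (restrictParts .some) addSingletonPart (fun P hP => ?_) (fun Q hQ => ?_)
    (fun P hP => ?_) (fun Q hQ => ?_) (fun P hP => ?_)
  · exact mem_indepFamilies.2 ((mem_indepFamilies.1 hP).restrictParts fun _ _ h => h)
  · exact mem_indepFamilies.2 (mem_indepFamilies.1 hQ).addSingletonPart
  · exact (mem_indepFamilies.1 hP).addSingletonPart_restrictParts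
  · exact restrictParts_addSingletonPart (mem_indepFamilies.1 hQ).empty_notMem
  · rw [← card_addSingletonPart, (mem_indepFamilies.1 hP).addSingletonPart_restrictParts]

end Dominating

/-! ### Partitions of a disjoint union -/

section Merge

variable {V W : Type} {G : SimpleGraph V} {H : SimpleGraph W}

theorem eq_empty_of_toLeft_toRight {T : Finset (V ⊕ W)} (h : T.toLeft = ∅) (h' : T.toRight = ∅) :
    T = ∅ := by
  rw [← Finset.toLeft_disjSum_toRight (u := T), h, h']
  simp

/-- A non-empty common trace gives a common vertex; distinct parts may both have empty trace. -/
theorem IsIndepPartition.eq_of_toLeft_eq {P : Finset (Finset (V ⊕ W))}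
    (h : IsIndepPartition (G ⊕g H) P) {T T' : Finset (V ⊕ W)} (hT : T ∈ P)
    (hT' : T' ∈ P) (hne : T.toLeft ≠ ∅) (heq : T.toLeft = T'.toLeft) : T = T' := by
  obtain ⟨v, hv⟩ := Finset.nonempty_iff_ne_empty.2 hne
  exact h.eq_of_mem T hT T' hT' (.inl v) (Finset.mem_toLeft.1 hv)
    (Finset.mem_toLeft.1 (heq ▸ hv))

theorem IsIndepPartition.eq_of_toRight_eq {P : Finset (Finset (V ⊕ W))}
    (h : IsIndepPartition (G ⊕g H) P) {T T' : Finset (V ⊕ W)} (hT : T ∈ P)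
    (hT' : T' ∈ P) (hne : T.toRight ≠ ∅) (heq : T.toRight = T'.toRight) : T = T' := by
  obtain ⟨v, hv⟩ := Finset.nonempty_iff_ne_empty.2 hne
  exact h.eq_of_mem T hT T' hT' (.inr v) (Finset.mem_toRight.1 hv)
    (Finset.mem_toRight.1 (heq ▸ hv))

variable [DecidableEq V] [DecidableEq W]

theorem mem_restrictParts_inl [Fintype V] {P : Finset (Finset (V ⊕ W))} {a : Finset V} :
    a ∈ restrictParts .inl P ↔ a ≠ ∅ ∧ ∃ T ∈ P, T.toLeft = a := by
  simp [mem_restrictParts, Finset.ext_iff]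

theorem mem_restrictParts_inr [Fintype W] {P : Finset (Finset (V ⊕ W))} {b : Finset W} :
    b ∈ restrictParts .inr P ↔ b ≠ ∅ ∧ ∃ T ∈ P, T.toRight = b := by
  simp [mem_restrictParts, Finset.ext_iff]

theorem IsIndepPartition.restrictParts_inl [Fintype V] {P : Finset (Finset (V ⊕ W))}
    (h : IsIndepPartition (G ⊕g H) P) :
    IsIndepPartition G (_root_.restrictParts .inl P) :=
  h.restrictParts fun _ _ h => h

theorem IsIndepPartition.restrictParts_inr [Fintype W] {P : Finset (Finset (V ⊕ W))}
    (h : IsIndepPartition (G ⊕g H) P) :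
    IsIndepPartition H (_root_.restrictParts .inr P) :=
  h.restrictParts fun _ _ h => h

variable [Fintype V] [Fintype W]

/-- The pairs of parts of the two induced partitions whose union is a part of `P`. -/
def mergedPairs (P : Finset (Finset (V ⊕ W))) : Finset (Finset V × Finset W) :=
  (restrictParts .inl P ×ˢ restrictParts .inr P).filter fun p => p.1.disjSum p.2 ∈ P

/-- The family obtained from `P₁` and `P₂` by merging the pairs in `S`. -/
def mergeParts (P₁ : Finset (Finset V)) (P₂ : Finset (Finset W))
    (S : Finset (Finset V × Finset W)) : Finset (Finset (V ⊕ W)) :=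
  Finset.univ.filter fun T => (T.toLeft, T.toRight) ∈ S ∨
    (T.toLeft ∈ P₁ ∧ T.toRight = ∅ ∧ ∀ b, (T.toLeft, b) ∉ S) ∨
    (T.toRight ∈ P₂ ∧ T.toLeft = ∅ ∧ ∀ a, (a, T.toRight) ∉ S)

theorem mem_mergeParts {P₁ : Finset (Finset V)} {P₂ : Finset (Finset W)}
    {S : Finset (Finset V × Finset W)} {T : Finset (V ⊕ W)} :
    T ∈ mergeParts P₁ P₂ S ↔ (T.toLeft, T.toRight) ∈ S ∨
      (T.toLeft ∈ P₁ ∧ T.toRight = ∅ ∧ ∀ b, (T.toLeft, b) ∉ S) ∨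
      (T.toRight ∈ P₂ ∧ T.toLeft = ∅ ∧ ∀ a, (a, T.toRight) ∉ S) := by
  simp [mergeParts]

theorem mem_mergedPairs {P : Finset (Finset (V ⊕ W))} {a : Finset V} {b : Finset W} :
    (a, b) ∈ mergedPairs P ↔ a ≠ ∅ ∧ b ≠ ∅ ∧ a.disjSum b ∈ P := by
  simp only [mergedPairs, Finset.mem_filter, Finset.mem_product, mem_restrictParts_inl,
    mem_restrictParts_inr]
  exact ⟨fun h => ⟨h.1.1.1, h.1.2.1, h.2⟩,
    fun h => ⟨⟨⟨h.1, _, h.2.2, by simp⟩, ⟨h.2.1, _, h.2.2, by simp⟩⟩, h.2.2⟩⟩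

namespace IsIndepPartition

variable {P : Finset (Finset (V ⊕ W))}

theorem mergedPairs_mem_rookPlacements (h : IsIndepPartition (G ⊕g H) P) :
    mergedPairs P ∈ rookPlacements (_root_.restrictParts .inl P) (_root_.restrictParts .inr P) := by
  rw [mem_rookPlacements]
  refine ⟨fun p hp => Finset.mem_product.1 (Finset.mem_of_mem_filter p hp), ?_⟩
  rintro ⟨a, b⟩ hp ⟨a', b'⟩ hp' hpp
  rw [mem_mergedPairs] at hp hp'
  have : a.disjSum b = a'.disjSum b' := by
    rcases hpp with hpp | hpp
    · exact h.eq_of_toLeft_eq hp.2.2 hp'.2.2 (by simpa using hp.1) (by simpa using hpp)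
    · exact h.eq_of_toRight_eq hp.2.2 hp'.2.2 (by simpa using hp.2.1) (by simpa using hpp)
  simpa using this

/-- Merging `i` pairs of parts decreases the number of parts by `i`. -/
theorem card_add_card_mergedPairs (h : IsIndepPartition (G ⊕g H) P) :
    P.card + (mergedPairs P).card =
      (_root_.restrictParts .inl P).card + (_root_.restrictParts .inr P).card := by
  -- This is inclusion–exclusion for the parts meeting the left side and those meeting the right.
  -- Their union is `P`, as no part is empty, and their intersection corresponds to the merged
  -- pairs.
  have h1 : _root_.restrictParts .inl P = (P.filter fun T => T.toLeft ≠ ∅).image Finset.toLeft := by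
    ext a
    simp only [mem_restrictParts_inl, Finset.mem_image, Finset.mem_filter]
    constructor
    · rintro ⟨hne, T, hT, rfl⟩
      exact ⟨T, ⟨hT, hne⟩, rfl⟩
    · rintro ⟨T, ⟨hT, hne⟩, rfl⟩
      exact ⟨hne, T, hT, rfl⟩
  have h2 : _root_.restrictParts .inr P =
      (P.filter fun T => T.toRight ≠ ∅).image Finset.toRight := by
    ext a
    simp only [mem_restrictParts_inr, Finset.mem_image, Finset.mem_filter]
    constructor
    · rintro ⟨hne, T, hT, rfl⟩
      exact ⟨T, ⟨hT, hne⟩, rfl⟩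
    · rintro ⟨T, ⟨hT, hne⟩, rfl⟩
      exact ⟨hne, T, hT, rfl⟩
  have h3 : mergedPairs P = ((P.filter fun T => T.toLeft ≠ ∅) ∩
      (P.filter fun T => T.toRight ≠ ∅)).image fun T => (T.toLeft, T.toRight) := by
    ext ⟨a, b⟩
    simp only [mem_mergedPairs, Finset.mem_image, Finset.mem_filter, Finset.mem_inter,
      Prod.mk.injEq]
    constructor
    · rintro ⟨ha, hb, hab⟩
      exact ⟨_, ⟨⟨hab, by simpa using ha⟩, ⟨hab, by simpa using hb⟩⟩, by simp, by simp⟩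
    · rintro ⟨T, ⟨⟨hT, ha⟩, ⟨-, hb⟩⟩, rfl, rfl⟩
      exact ⟨ha, hb, by rwa [Finset.toLeft_disjSum_toRight]⟩
  have h4 : P = (P.filter fun T => T.toLeft ≠ ∅) ∪ (P.filter fun T => T.toRight ≠ ∅) := by
    rw [← Finset.filter_or, Finset.filter_true_of_mem]
    intro T hT
    by_contra hcon
    push Not at hcon
    exact h.empty_notMem (eq_empty_of_toLeft_toRight hcon.1 hcon.2 ▸ hT)
  rw [h1, h2, h3, Finset.card_image_of_injOn, Finset.card_image_of_injOn,
    Finset.card_image_of_injOn, congrArg Finset.card h4, Finset.card_union_add_card_inter]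
  · intro T hT T' hT' heq
    simp only [Finset.coe_filter, Set.mem_ofPred_eq] at hT hT'
    exact h.eq_of_toRight_eq hT.1 hT'.1 hT.2 heq
  · intro T hT T' hT' heq
    simp only [Finset.coe_filter, Set.mem_ofPred_eq] at hT hT'
    exact h.eq_of_toLeft_eq hT.1 hT'.1 hT.2 heq
  · intro T _ T' _ heq
    rw [← Finset.toLeft_disjSum_toRight (u := T), ← Finset.toLeft_disjSum_toRight (u := T')]
    simp only [Prod.mk.injEq] at heq
    rw [heq.1, heq.2]

theorem mergeParts_mergedPairs (h : IsIndepPartition (G ⊕g H) P) :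
    mergeParts (_root_.restrictParts .inl P) (_root_.restrictParts .inr P) (mergedPairs P) = P := by
  ext T
  have hT0 : T.toLeft.disjSum T.toRight = T := Finset.toLeft_disjSum_toRight
  rw [mem_mergeParts, mem_mergedPairs, hT0, mem_restrictParts_inl, mem_restrictParts_inr]
  simp only [mem_mergedPairs]
  constructor
  · rintro (⟨-, -, hT⟩ | ⟨⟨hne, T', hT', heq⟩, h0, hun⟩ | ⟨⟨hne, T', hT', heq⟩, h0, hun⟩)
    · exact hT
    -- Otherwise `T'` would itself provide a merged pair with the left trace of `T`, which `hun`
    -- excludes. So `T'` and `T` agree on both sides.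
    · have h0' : T'.toRight = ∅ := by
        by_contra hne'
        exact hun _ ⟨hne, hne', by rwa [← heq, Finset.toLeft_disjSum_toRight]⟩
      rwa [← hT0, h0, ← h0', ← heq, Finset.toLeft_disjSum_toRight]
    · have h0' : T'.toLeft = ∅ := by
        by_contra hne'
        exact hun _ ⟨hne', hne, by rwa [← heq, Finset.toLeft_disjSum_toRight]⟩
      rwa [← hT0, h0, ← h0', ← heq, Finset.toLeft_disjSum_toRight]
  · intro hT
    by_cases hl : T.toLeft = ∅
    · have hr : T.toRight ≠ ∅ := fun hr =>
        h.empty_notMem (eq_empty_of_toLeft_toRight hl hr ▸ hT)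
      refine .inr (.inr ⟨⟨hr, T, hT, rfl⟩, hl, ?_⟩)
      rintro a ⟨ha, -, hab⟩
      have := h.eq_of_toRight_eq hT hab hr (by simp)
      rw [this] at hl
      simp [ha] at hl
    · by_cases hr : T.toRight = ∅
      · refine .inr (.inl ⟨⟨hl, T, hT, rfl⟩, hr, ?_⟩)
        rintro b ⟨-, hb, hab⟩
        have := h.eq_of_toLeft_eq hT hab hl (by simp)
        rw [this] at hr
        simp [hb] at hr
      · exact .inl ⟨hl, hr, hT⟩

end IsIndepPartition

/-! ### From two partitions and a rook placement to a partition of the disjoint union -/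

section

variable {P₁ : Finset (Finset V)} {P₂ : Finset (Finset W)} {S : Finset (Finset V × Finset W)}

theorem exists_mem_mergeParts_toLeft {a : Finset V} (ha : a ∈ P₁) :
    ∃ T ∈ mergeParts P₁ P₂ S, T.toLeft = a := by
  by_cases hb : ∃ b, (a, b) ∈ S
  · obtain ⟨b, hb⟩ := hb
    exact ⟨a.disjSum b, mem_mergeParts.2 (.inl (by simpa using hb)), by simp⟩
  · refine ⟨a.disjSum ∅, mem_mergeParts.2 (.inr (.inl ?_)), Finset.toLeft_disjSum⟩
    rw [Finset.toLeft_disjSum, Finset.toRight_disjSum]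
    exact ⟨ha, rfl, not_exists.1 hb⟩

theorem exists_mem_mergeParts_toRight {b : Finset W} (hb : b ∈ P₂) :
    ∃ T ∈ mergeParts P₁ P₂ S, T.toRight = b := by
  by_cases ha : ∃ a, (a, b) ∈ S
  · obtain ⟨a, ha⟩ := ha
    exact ⟨a.disjSum b, mem_mergeParts.2 (.inl (by simpa using ha)), by simp⟩
  · refine ⟨(∅ : Finset V).disjSum b, mem_mergeParts.2 (.inr (.inr ?_)), Finset.toRight_disjSum⟩
    rw [Finset.toLeft_disjSum, Finset.toRight_disjSum]
    exact ⟨hb, rfl, not_exists.1 ha⟩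

theorem toLeft_eq_empty_or_mem (hS : S ∈ rookPlacements P₁ P₂) {T : Finset (V ⊕ W)}
    (hT : T ∈ mergeParts P₁ P₂ S) : T.toLeft = ∅ ∨ T.toLeft ∈ P₁ := by
  rcases mem_mergeParts.1 hT with h | h | h
  · exact .inr ((mem_rookPlacements.1 hS).1 _ h).1
  · exact .inr h.1
  · exact .inl h.2.1

theorem toRight_eq_empty_or_mem (hS : S ∈ rookPlacements P₁ P₂) {T : Finset (V ⊕ W)}
    (hT : T ∈ mergeParts P₁ P₂ S) : T.toRight = ∅ ∨ T.toRight ∈ P₂ := by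
  rcases mem_mergeParts.1 hT with h | h | h
  · exact .inr ((mem_rookPlacements.1 hS).1 _ h).2
  · exact .inl h.2.1
  · exact .inr h.1

theorem restrictParts_inl_mergeParts (h₁ : ∅ ∉ P₁) (hS : S ∈ rookPlacements P₁ P₂) :
    restrictParts .inl (mergeParts P₁ P₂ S) = P₁ := by
  ext a
  rw [mem_restrictParts_inl]
  constructor
  · rintro ⟨hne, T, hT, rfl⟩
    exact (toLeft_eq_empty_or_mem hS hT).resolve_left hne
  · exact fun ha => ⟨fun h => h₁ (h ▸ ha), exists_mem_mergeParts_toLeft ha⟩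

theorem restrictParts_inr_mergeParts (h₂ : ∅ ∉ P₂) (hS : S ∈ rookPlacements P₁ P₂) :
    restrictParts .inr (mergeParts P₁ P₂ S) = P₂ := by
  ext b
  rw [mem_restrictParts_inr]
  constructor
  · rintro ⟨hne, T, hT, rfl⟩
    exact (toRight_eq_empty_or_mem hS hT).resolve_left hne
  · exact fun hb => ⟨fun h => h₂ (h ▸ hb), exists_mem_mergeParts_toRight hb⟩

theorem mergedPairs_mergeParts (h₁ : ∅ ∉ P₁) (h₂ : ∅ ∉ P₂) (hS : S ∈ rookPlacements P₁ P₂) :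
    mergedPairs (mergeParts P₁ P₂ S) = S := by
  ext ⟨a, b⟩
  rw [mem_mergedPairs, mem_mergeParts, Finset.toLeft_disjSum, Finset.toRight_disjSum]
  constructor
  · rintro ⟨ha, hb, h | h | h⟩
    · exact h
    · exact absurd h.2.1 hb
    · exact absurd h.2.1 ha
  · intro h
    have := (mem_rookPlacements.1 hS).1 _ h
    exact ⟨fun h => h₁ (h ▸ this.1), fun h => h₂ (h ▸ this.2), .inl h⟩

/-- A vertex determines the trace on its own side because that side is partitioned, and the trace on
the other side because a row or column holds at most one rook. Independence is checked on each side,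
as no edge joins the two. -/
theorem IsIndepPartition.mergeParts (h₁ : IsIndepPartition G P₁) (h₂ : IsIndepPartition H P₂)
    (hS : S ∈ rookPlacements P₁ P₂) :
    IsIndepPartition (G ⊕g H) (_root_.mergeParts P₁ P₂ S) where
  empty_notMem := by
    intro h
    rw [mem_mergeParts] at h
    rcases h with h | h | h
    · exact h₁.empty_notMem ((mem_rookPlacements.1 hS).1 _ h).1
    · exact h₁.empty_notMem h.1
    · exact h₂.empty_notMem h.1
  exists_mem v := by
    rcases v with v | v
    · obtain ⟨a, ha, hv⟩ := h₁.exists_mem v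
      obtain ⟨T, hT, rfl⟩ := exists_mem_mergeParts_toLeft (P₂ := P₂) (S := S) ha
      exact ⟨T, hT, Finset.mem_toLeft.1 hv⟩
    · obtain ⟨b, hb, hv⟩ := h₂.exists_mem v
      obtain ⟨T, hT, rfl⟩ := exists_mem_mergeParts_toRight (P₁ := P₁) (S := S) hb
      exact ⟨T, hT, Finset.mem_toRight.1 hv⟩
  eq_of_mem T hT T' hT' v hv hv' := by
    have hna := (mem_rookPlacements.1 hS).2
    rcases v with v | v
    · rw [← Finset.mem_toLeft] at hv hv'
      have hl := (toLeft_eq_empty_or_mem hS hT).resolve_left (Finset.ne_empty_of_mem hv)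
      have hl' := (toLeft_eq_empty_or_mem hS hT').resolve_left (Finset.ne_empty_of_mem hv')
      have heq := h₁.eq_of_mem _ hl _ hl' v hv hv'
      suffices T.toRight = T'.toRight by
        rw [← Finset.toLeft_disjSum_toRight (u := T), ← Finset.toLeft_disjSum_toRight (u := T'),
          heq, this]
      rcases mem_mergeParts.1 hT with h | h | h
      · rcases mem_mergeParts.1 hT' with h' | h' | h'
        · exact (Prod.ext_iff.1 (hna _ h _ h' (.inl heq))).2
        · exact absurd (heq ▸ h) (h'.2.2 _)
        · exact absurd h'.2.1 (Finset.ne_empty_of_mem hv')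
      · rcases mem_mergeParts.1 hT' with h' | h' | h'
        · exact absurd (heq ▸ h') (h.2.2 _)
        · rw [h.2.1, h'.2.1]
        · exact absurd h'.2.1 (Finset.ne_empty_of_mem hv')
      · exact absurd h.2.1 (Finset.ne_empty_of_mem hv)
    · rw [← Finset.mem_toRight] at hv hv'
      have hl := (toRight_eq_empty_or_mem hS hT).resolve_left (Finset.ne_empty_of_mem hv)
      have hl' := (toRight_eq_empty_or_mem hS hT').resolve_left (Finset.ne_empty_of_mem hv')
      have heq := h₂.eq_of_mem _ hl _ hl' v hv hv'
      suffices T.toLeft = T'.toLeft by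
        rw [← Finset.toLeft_disjSum_toRight (u := T), ← Finset.toLeft_disjSum_toRight (u := T'),
          heq, this]
      rcases mem_mergeParts.1 hT with h | h | h
      · rcases mem_mergeParts.1 hT' with h' | h' | h'
        · exact (Prod.ext_iff.1 (hna _ h _ h' (.inr heq))).1
        · exact absurd h'.2.1 (Finset.ne_empty_of_mem hv')
        · exact absurd (heq ▸ h) (h'.2.2 _)
      · exact absurd h.2.1 (Finset.ne_empty_of_mem hv)
      · rcases mem_mergeParts.1 hT' with h' | h' | h'
        · exact absurd (heq ▸ h') (h.2.2 _)
        · exact absurd h'.2.1 (Finset.ne_empty_of_mem hv')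
        · rw [h.2.1, h'.2.1]
  indep T hT := by
    rintro (u | u) hu (v | v) hv huv hadj
    · have hu' : u ∈ T.toLeft := Finset.mem_toLeft.2 hu
      have hl := (toLeft_eq_empty_or_mem hS hT).resolve_left (Finset.ne_empty_of_mem hu')
      exact h₁.indep _ hl hu' (Finset.mem_toLeft.2 hv) (fun h => huv (h ▸ rfl)) hadj
    · simp at hadj
    · simp at hadj
    · have hu' : u ∈ T.toRight := Finset.mem_toRight.2 hu
      have hl := (toRight_eq_empty_or_mem hS hT).resolve_left (Finset.ne_empty_of_mem hu')
      exact h₂.indep _ hl hu' (Finset.mem_toRight.2 hv) (fun h => huv (h ▸ rfl)) hadj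

end

/-- Partitions of a disjoint union correspond to pairs of partitions of the two sides together
with a placement of non-attacking rooks. -/
theorem sum_indepFamilies_sum (G : SimpleGraph V) (H : SimpleGraph W) {M : Type*}
    [AddCommMonoid M] (F : Finset (Finset V) → Finset (Finset W) →
      Finset (Finset V × Finset W) → M) :
    ∑ P ∈ indepFamilies (G ⊕g H), F (restrictParts .inl P) (restrictParts .inr P) (mergedPairs P) =
      ∑ P₁ ∈ indepFamilies G, ∑ P₂ ∈ indepFamilies H, ∑ S ∈ rookPlacements P₁ P₂, F P₁ P₂ S := by
  rw [← Finset.sum_product', Finset.sum_sigma']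
  refine Finset.sum_bij'
    (i := fun P _ => (⟨(restrictParts .inl P, restrictParts .inr P), mergedPairs P⟩ :
      Σ _ : Finset (Finset V) × Finset (Finset W), Finset (Finset V × Finset W)))
    (j := fun p _ => mergeParts p.1.1 p.1.2 p.2) ?_ ?_ ?_ ?_ ?_
  · intro P hP
    have h := mem_indepFamilies.1 hP
    simp only [Finset.mem_sigma, Finset.mem_product, mem_indepFamilies]
    exact ⟨⟨h.restrictParts_inl, h.restrictParts_inr⟩, h.mergedPairs_mem_rookPlacements⟩
  · rintro ⟨⟨P₁, P₂⟩, S⟩ hp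
    simp only [Finset.mem_sigma, Finset.mem_product, mem_indepFamilies] at hp ⊢
    exact hp.1.1.mergeParts hp.1.2 hp.2
  · intro P hP
    exact (mem_indepFamilies.1 hP).mergeParts_mergedPairs
  · rintro ⟨⟨P₁, P₂⟩, S⟩ hp
    simp only [Finset.mem_sigma, Finset.mem_product, mem_indepFamilies] at hp
    have h₁ := hp.1.1.empty_notMem
    have h₂ := hp.1.2.empty_notMem
    simp only [restrictParts_inl_mergeParts h₁ hp.2, restrictParts_inr_mergeParts h₂ hp.2,
      mergedPairs_mergeParts h₁ h₂ hp.2]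
  · intro P _
    rfl

/-- The entries `1` are the merged pairs. These all lie on the board, so quantifying over arbitrary
sets in `rookWeight` adds no rooks. -/
theorem matrixWeight_mergeMatrix (r : Finset V → Finset V → Prop) (s : Finset W → Finset W → Prop)
    (P : Finset (Finset (V ⊕ W))) :
    matrixWeight (fun a a' : restrictParts .inl P => r a a')
      (fun b b' : restrictParts .inr P => s b b') (mergeMatrix P) =
      rookWeight r s (restrictParts .inl P) (restrictParts .inr P) (mergedPairs P) := by
  classical
  have hmem : ∀ (a : restrictParts .inl P) (b : restrictParts .inr P),
      (a : Finset V).disjSum (b : Finset W) ∈ P ↔ ((a : Finset V), (b : Finset W)) ∈ mergedPairs P :=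
    fun a b => by simp [mergedPairs]
  have hsub : ∀ a b, (a, b) ∈ mergedPairs P →
      a ∈ restrictParts .inl P ∧ b ∈ restrictParts .inr P := fun a b h =>
    Finset.mem_product.1 (Finset.mem_of_mem_filter _ h)
  unfold matrixWeight rookWeight
  refine Finset.card_bij (fun p _ => ((p.1 : Finset V), (p.2 : Finset W))) ?_ ?_ ?_
  · rintro ⟨a, b⟩ hp
    simp only [Finset.mem_filter, Finset.mem_univ, true_and, mergeMatrix, Matrix.of_apply, hmem,
      ite_eq_right_iff, one_ne_zero, imp_false, ite_eq_left_iff, zero_ne_one, not_not,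
      not_exists, not_and] at hp
    simp only [Finset.mem_filter, Finset.mem_product]
    exact ⟨⟨a.2, b.2⟩, hp.1, fun i hi hia => hp.2.1 ⟨i, (hsub _ _ hi).1⟩ hia hi,
      fun j hj hjb => hp.2.2 ⟨j, (hsub _ _ hj).2⟩ hjb hj⟩
  · rintro ⟨a, b⟩ _ ⟨a', b'⟩ _ h
    simp only [Prod.mk.injEq, Subtype.coe_inj] at h
    rw [h.1, h.2]
  · rintro ⟨a, b⟩ hp
    simp only [Finset.mem_filter, Finset.mem_product] at hp
    refine ⟨(⟨a, hp.1.1⟩, ⟨b, hp.1.2⟩), ?_, rfl⟩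
    simp only [Finset.mem_filter, Finset.mem_univ, true_and, mergeMatrix, Matrix.of_apply, hmem,
      ite_eq_right_iff, one_ne_zero, imp_false, ite_eq_left_iff, zero_ne_one, not_not,
      not_exists, not_and]
    exact ⟨hp.2.1, fun i hia hi => hp.2.2.1 i hi hia, fun j hjb hj => hp.2.2.2 j hj hjb⟩

end Merge

/-! ### The normal order of a Dyck word as a sum over partitions -/

section NormalOrder

/-- The element of the `q`-deformed Weyl algebra given by the Dyck word of a tree. -/
noncomputable def treeEval : BinaryTree Unit → QWeyl
  | .nil => 1
  | .node _ l r => qGen .U * treeEval l * qGen .D * treeEval r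

theorem qEval_ofTree (t : BinaryTree Unit) : qEval (DyckWord.ofTree t).toList = treeEval t := by
  induction t with
  | nil => rfl
  | node _ l r ihl ihr =>
    have : (DyckWord.ofTree (.node () l r)).toList = [.U] ++ (DyckWord.ofTree l).toList ++ [.D] ++
      (DyckWord.ofTree r).toList := rfl
    simp only [qEval, treeEval] at *
    rw [this, List.map_append, List.prod_append, List.map_append, List.prod_append,
      List.map_append, List.prod_append, ihl, ihr]
    simp

theorem qGen_D_mul_qGen_U : qGen .D * qGen .U = (X : ℤ[X]) • (qGen .U * qGen .D) + 1 := by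
  simpa [qGen] using RingQuot.mkAlgHom_rel ℤ[X] QWeylRel.comm

/-- All `k` are treated at once, since multiplication in the algebra mixes them. The induction
hypothesis covers every order, as the subtrees carry restricted ones. -/
theorem sum_treeWeight (t : BinaryTree Unit) (lt : Finset (TreeVertex t) → Finset (TreeVertex t) → Prop)
    (hlt : StrictTotalOn lt {s | (treeGraph t).IsIndepSet (s : Set (TreeVertex t))}) :
    ∑ P ∈ indepFamilies (treeGraph t), (X ^ treeWeight t lt P : ℤ[X]) •
      (qGen .U ^ P.card * qGen .D ^ P.card) = treeEval t := by
  induction t with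
  | nil =>
    have : indepFamilies (treeGraph .nil) = {∅} := by
      ext P
      rw [mem_indepFamilies, Finset.mem_singleton]
      constructor
      · intro h
        refine Finset.eq_empty_of_forall_notMem fun s hs => h.empty_notMem ?_
        rwa [← Finset.eq_empty_of_forall_notMem (s := s) fun a _ => (show Empty from a).elim]
      · rintro rfl
        exact ⟨Finset.notMem_empty _, fun v => (show Empty from v).elim,
          fun _ h => absurd h (Finset.notMem_empty _), fun _ h => absurd h (Finset.notMem_empty _)⟩
    rw [this]
    simp [treeWeight, treeEval]
  | node _ l r ihl ihr =>
    let G := addDominating (treeGraph l)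
    let H := treeGraph r
    let lt₁ : Finset (Option (TreeVertex l)) → Finset (Option (TreeVertex l)) → Prop :=
      restrictLt (.inl : Option (TreeVertex l) ↪ Option (TreeVertex l) ⊕ TreeVertex r) lt
    let lt₂ : Finset (TreeVertex r) → Finset (TreeVertex r) → Prop :=
      restrictLt (.inr : TreeVertex r ↪ Option (TreeVertex l) ⊕ TreeVertex r) lt
    let w₁ : Finset (Finset (Option (TreeVertex l))) → ℕ := fun P₁ =>
      treeWeight l (restrictLt .some lt₁) (restrictParts .some P₁)
    let w₂ : Finset (Finset (TreeVertex r)) → ℕ := treeWeight r lt₂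
    have hlt' : StrictTotalOn lt {s : Finset (Option (TreeVertex l) ⊕ TreeVertex r) |
      (G ⊕g H).IsIndepSet (s : Set (Option (TreeVertex l) ⊕ TreeVertex r))} := hlt
    have hlt₁ : StrictTotalOn lt₁ {s | G.IsIndepSet (s : Set (Option (TreeVertex l)))} :=
      hlt'.restrictLt fun _ _ h => h
    have hlt₂ : StrictTotalOn lt₂ {s | H.IsIndepSet (s : Set (TreeVertex r))} :=
      hlt'.restrictLt fun _ _ h => h
    have ihl' := ihl (restrictLt .some lt₁) (hlt₁.restrictLt fun _ _ h => h)
    have ihr' := ihr lt₂ hlt₂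
    -- The summand in terms of the two induced partitions and the rook placement, with `|P|` written
    -- as `|P₁| + |P₂| - |S|`.
    let F : Finset (Finset (Option (TreeVertex l))) → Finset (Finset (TreeVertex r)) →
      Finset (Finset (Option (TreeVertex l)) × Finset (TreeVertex r)) → QWeyl := fun P₁ P₂ S =>
        (X ^ (w₁ P₁ + w₂ P₂ + rookWeight lt₁ lt₂ P₁ P₂ S) : ℤ[X]) •
          (qGen .U ^ (P₁.card + P₂.card - S.card) * qGen .D ^ (P₁.card + P₂.card - S.card))
    have hF : ∑ P ∈ indepFamilies (treeGraph (.node () l r)),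
        (X ^ treeWeight (.node () l r) lt P : ℤ[X]) • (qGen .U ^ P.card * qGen .D ^ P.card) =
        ∑ P ∈ indepFamilies (G ⊕g H),
          F (restrictParts .inl P) (restrictParts .inr P) (mergedPairs P) := by
      refine Finset.sum_congr rfl
        fun (P : Finset (Finset (Option (TreeVertex l) ⊕ TreeVertex r))) hP => ?_
      have hcard := (mem_indepFamilies.1 hP : IsIndepPartition (G ⊕g H) P).card_add_card_mergedPairs
      have hw : treeWeight (.node () l r) lt P = w₁ (restrictParts .inl P) +
          w₂ (restrictParts .inr P) + rookWeight lt₁ lt₂ (restrictParts .inl P)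
            (restrictParts .inr P) (mergedPairs P) :=
        congrArg (w₁ (restrictParts .inl P) + w₂ (restrictParts .inr P) + ·)
          (matrixWeight_mergeMatrix lt₁ lt₂ P)
      simp only [F]
      rw [hw, ← hcard, Nat.add_sub_cancel]
      rfl
    have hG : ∑ P₁ ∈ indepFamilies G, (X ^ w₁ P₁ : ℤ[X]) •
        (qGen .U ^ P₁.card * qGen .D ^ P₁.card) = qGen .U * treeEval l * qGen .D := by
      rw [← ihl', sum_indepFamilies_addDominating (treeGraph l) fun Q n =>
        (X ^ treeWeight l (restrictLt .some lt₁) Q : ℤ[X]) • (qGen .U ^ n * qGen .D ^ n),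
        Finset.mul_sum, Finset.sum_mul]
      refine Finset.sum_congr rfl fun Q _ => ?_
      rw [mul_smul_comm, smul_mul_assoc, pow_succ', pow_succ]
      simp only [mul_assoc]
    rw [hF, sum_indepFamilies_sum, treeEval, ← hG, ← ihr', Finset.sum_mul_sum]
    refine Finset.sum_congr rfl fun P₁ hP₁ => Finset.sum_congr rfl fun P₂ hP₂ => ?_
    have hrook := sum_rookPlacements qGen_D_mul_qGen_U P₁ P₂
      (hlt₁.mono fun s hs => (mem_indepFamilies.1 hP₁).indep s hs)
      (hlt₂.mono fun s hs => (mem_indepFamilies.1 hP₂).indep s hs)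
    have hassoc : (qGen .U ^ P₁.card * qGen .D ^ P₁.card) * (qGen .U ^ P₂.card * qGen .D ^ P₂.card) =
        qGen .U ^ P₁.card * (qGen .D ^ P₁.card * qGen .U ^ P₂.card) * qGen .D ^ P₂.card := by
      simp only [mul_assoc]
    rw [smul_mul_smul_comm, hassoc, ← hrook, Finset.mul_sum, Finset.sum_mul, Finset.smul_sum]
    refine Finset.sum_congr rfl fun S hS => ?_
    -- These bounds make the truncated subtractions in the exponents genuine.
    have hle := card_le_of_mem_rookPlacements hS
    simp only [F]
    rw [mul_smul_comm, smul_mul_assoc, smul_smul, ← pow_add, ← pow_add, ← mul_assoc, ← pow_add,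
      mul_assoc, ← pow_add, ← Nat.add_sub_assoc hle.2, ← Nat.sub_add_comm hle.1]

end NormalOrder

/-! ### Uniqueness of the normal order -/

section Uniqueness

/-- The shift operator on sequences. -/
noncomputable def seqShift : Module.End ℤ[X] (ℕ → ℤ[X]) where
  toFun f n := if n = 0 then 0 else f (n - 1)
  map_add' f g := by ext1 n; by_cases h : n = 0 <;> simp [h]
  map_smul' c f := by ext1 n; by_cases h : n = 0 <;> simp [h]

/-- The `q`-derivative on sequences, seen as coefficients of power series. -/
noncomputable def seqDeriv : Module.End ℤ[X] (ℕ → ℤ[X]) where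
  toFun f n := (∑ i ∈ Finset.range (n + 1), X ^ i) * f (n + 1)
  map_add' f g := by ext1 n; simp [mul_add]
  map_smul' c f := by ext1 n; simp [mul_left_comm]

/-- Coefficientwise this is `[n+1] = q [n] + 1` for `q`-integers. -/
theorem seqDeriv_mul_seqShift :
    seqDeriv * seqShift = (X : ℤ[X]) • (seqShift * seqDeriv) + 1 := by
  refine LinearMap.ext fun f => funext fun n => ?_
  rcases n with _ | n
  · simp [seqDeriv, seqShift]
  · simp [seqDeriv, seqShift, Finset.sum_range_succ' _ (n + 1), pow_succ', ← Finset.mul_sum]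
    ring

/-- The representation of the `q`-deformed Weyl algebra on sequences. -/
noncomputable def seqRep : QWeyl →ₐ[ℤ[X]] Module.End ℤ[X] (ℕ → ℤ[X]) :=
  RingQuot.liftAlgHom ℤ[X] ⟨FreeAlgebra.lift ℤ[X] fun
    | .U => seqShift
    | .D => seqDeriv, by
      rintro _ _ ⟨⟩
      simpa using seqDeriv_mul_seqShift⟩

theorem seqRep_qGen_U : seqRep (qGen .U) = seqShift := by
  rw [qGen, seqRep, RingQuot.liftAlgHom_mkAlgHom_apply, FreeAlgebra.lift_ι_apply]

theorem seqRep_qGen_D : seqRep (qGen .D) = seqDeriv := by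
  rw [qGen, seqRep, RingQuot.liftAlgHom_mkAlgHom_apply, FreeAlgebra.lift_ι_apply]

theorem seqShift_pow_apply (k : ℕ) (f : ℕ → ℤ[X]) (n : ℕ) :
    (seqShift ^ k) f n = if n < k then 0 else f (n - k) := by
  induction k generalizing n with
  | zero => simp
  | succ k ih =>
    rw [pow_succ']
    change (if n = 0 then 0 else (seqShift ^ k) f (n - 1)) = _
    rw [ih]
    rcases n with _ | n
    · simp
    · simp

/-- The `q`-analogue of reading off `k!` times a Taylor coefficient at `0`. -/
theorem seqDeriv_pow_apply_zero (k : ℕ) (f : ℕ → ℤ[X]) :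
    (seqDeriv ^ k) f 0 = (∏ j ∈ Finset.range k, ∑ i ∈ Finset.range (j + 1), X ^ i) * f k := by
  induction k generalizing f with
  | zero => simp
  | succ k ih =>
    rw [pow_succ, Module.End.mul_apply, ih, Finset.prod_range_succ, mul_assoc]
    rfl

/-- At `q = 1` the factor with index `j` becomes `j + 1`. -/
theorem qFactorial_ne_zero (k : ℕ) :
    (∏ j ∈ Finset.range k, ∑ i ∈ Finset.range (j + 1), X ^ i : ℤ[X]) ≠ 0 := by
  refine Finset.prod_ne_zero_iff.2 fun j _ h => ?_
  have := congrArg (Polynomial.eval 1) h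
  simp [Polynomial.eval_finsetSum] at this
  omega

/-- A triangular system: coordinate `n` of a relation applied to the `n`-th unit sequence has no
terms with `k > n`, because the shift gives zero there, and none with `k < n` by induction. What
remains is `c n` times the `q`-factorial of `n`, in a domain. -/
theorem linearIndependent_seqShift_pow_mul_seqDeriv_pow :
    LinearIndependent ℤ[X] fun k : ℕ => seqShift ^ k * seqDeriv ^ k := by
  rw [linearIndependent_iff]
  intro c hc
  ext1 n
  induction n using Nat.strong_induction_on with
  | _ n ih =>
  have h := congrFun (LinearMap.congr_fun hc (Pi.single n 1)) n
  rw [Finsupp.linearCombination_apply, Finsupp.sum, LinearMap.sum_apply, Finset.sum_apply,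
    Finset.sum_eq_single n] at h
  · rw [LinearMap.smul_apply, Pi.smul_apply, Module.End.mul_apply, seqShift_pow_apply,
      if_neg (lt_irrefl n), Nat.sub_self, seqDeriv_pow_apply_zero, Pi.single_eq_same, mul_one,
      smul_eq_mul] at h
    exact (mul_eq_zero.1 h).resolve_right (qFactorial_ne_zero n)
  · intro k _ hkn
    rcases lt_or_gt_of_ne hkn with hlt | hgt
    · rw [ih k hlt]
      simp
    · rw [LinearMap.smul_apply, Pi.smul_apply, Module.End.mul_apply, seqShift_pow_apply,
        if_pos hgt, smul_zero]
  · intro hn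
    rw [Finsupp.notMem_support_iff.1 hn]
    simp

/-- An element has at most one expansion into normally ordered monomials. -/
theorem eq_of_sum_normalOrder_eq {c c' : ℕ →₀ ℤ[X]}
    (h : (c.sum fun k a => a • (qGen .U ^ k * qGen .D ^ k)) =
      c'.sum fun k a => a • (qGen .U ^ k * qGen .D ^ k)) : c = c' := by
  have hrep : ∀ c : ℕ →₀ ℤ[X], seqRep (c.sum fun k a => a • (qGen .U ^ k * qGen .D ^ k)) =
      Finsupp.linearCombination ℤ[X] (fun k : ℕ => seqShift ^ k * seqDeriv ^ k) c := by
    intro c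
    rw [Finsupp.sum, map_sum, Finsupp.linearCombination_apply, Finsupp.sum]
    refine Finset.sum_congr rfl fun k _ => ?_
    rw [map_smul, map_mul, map_pow, map_pow, seqRep_qGen_U, seqRep_qGen_D]
  exact linearIndependent_seqShift_pow_mul_seqDeriv_pow (by rw [← hrep, h, hrep])

end Uniqueness

/-! ### The main theorem -/

theorem theorem7 (w : DyckWord)
    (lt : Finset (DyckVertex w) → Finset (DyckVertex w) → Prop)
    (hlt : IsStrictTotalOrder
      {s : Finset (DyckVertex w) // (dyckGraph w).IsIndepSet (s : Set (DyckVertex w))}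
      (fun s t => lt s t)) :
    (∃! c : ℕ →₀ ℤ[X], IsQNormalOrder w c) ∧
      ∀ k : ℕ, ∑ P ∈ indepPartitions (dyckGraph w) k, (X : ℤ[X]) ^ dyckWeight w lt P =
        qStirling w k := by
  classical
  have hlt' : StrictTotalOn lt {s | (dyckGraph w).IsIndepSet (s : Set (DyckVertex w))} :=
    { irrefl := fun a ha => hlt.irrefl ⟨a, ha⟩
      trans := fun a ha b hb c hc => hlt.trans ⟨a, ha⟩ ⟨b, hb⟩ ⟨c, hc⟩
      total := fun a ha b hb hab => by
        by_contra hcon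
        rw [not_or] at hcon
        exact hab (congrArg Subtype.val (hlt.trichotomous ⟨a, ha⟩ ⟨b, hb⟩ hcon.1 hcon.2)) }
  -- Grouping the partitions by number of parts turns `sum_treeWeight` into an expansion with these
  -- coefficients.
  let c : ℕ →₀ ℤ[X] := ∑ P ∈ indepFamilies (dyckGraph w),
    Finsupp.single P.card (X ^ treeWeight w.toTree lt P)
  have hc : IsQNormalOrder w c := by
    have h := qEval_ofTree w.toTree
    rw [DyckWord.ofTree_toTree] at h
    rw [IsQNormalOrder, h, ← sum_treeWeight w.toTree lt hlt', ← Finsupp.sum_finsetSum_index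
      (h := fun k (a : ℤ[X]) => a • (qGen .U ^ k * qGen .D ^ k))
      (fun _ => zero_smul _ _) (fun _ _ _ => add_smul _ _ _)]
    refine Finset.sum_congr rfl fun P _ => ?_
    rw [Finsupp.sum_single_index (h := fun k (a : ℤ[X]) => a • (qGen .U ^ k * qGen .D ^ k))
      (zero_smul _ _)]
  have huniq : ∀ c', IsQNormalOrder w c' → c' = c := fun c' hc' =>
    eq_of_sum_normalOrder_eq (hc'.symm.trans hc)
  refine ⟨⟨c, hc, huniq⟩, fun k => ?_⟩
  -- Since an expansion exists, `Classical.epsilon` returns one, and uniqueness makes it `c`.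
  rw [qStirling, huniq _ (Classical.epsilon_spec ⟨c, hc⟩)]
  unfold dyckWeight
  rw [sum_indepPartitions (dyckGraph w) k fun P => (X : ℤ[X]) ^ treeWeight w.toTree lt P,
    Finset.sum_filter, Finsupp.finsetSum_apply]
  simp only [Finsupp.single_apply]
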